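/- **Conventions.** Points $p\ne q$ of $\mathbb Z^2$ are $c_1$-adjacent if $|p_1-q_1|+|p_2-q_2|=1$, and $c_2$-adjacent if $|p_1-q_1|\le 1$ and $|p_2-q_2|\le 1$; they are diagonally adjacent if they are $c_2$- but not $c_1$-adjacent. A set is $\kappa$-connected if any two of its points are joined by a $\kappa$-path inside it. For $X\subset\mathbb Z^2$, a map $f:X\to X$ is $c_2$-continuous if it sends $c_2$-connected sets to $c_2$-connected sets; $x\in X$ is a $c_2$-approximate fixed point of $f$ if $f(x)$ is equal or $c_2$-adjacent to $x$. A set $A\subset X$ is a freezing set for $(X,c_2)$ if every $c_2$-continuous $g:X\to X$ with $g(a)=a$ for all $a\in A$ is the identity. A *closed curve* is a $c_2$-path $S=(s_0,s_1,\dots,s_m=s_0)$, $m\ge 1$, with $s_0,\dots,s_{m-1}$ distinct (indices modulo $m$). A *maximal segment* of $S$ is a set of consecutive points $s_i,s_{i+1},\dots,s_{i+L}$, $L\ge 1$, with all steps $s_{j+1}-s_j$ $(i\le j<i+L)$ equal, that cannot be extended along the curve in either direction; its endpoints are $s_i$ and $s_{i+L}$. It is axis-parallel if it is horizontal or vertical,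 and slanted if it has slope $\pm1$. If $\mathbb Z^2\setminus S$ has exactly two $c_1$-components, one finite, called $\mathrm{Int}(S)$, and one infinite, then $D=S\cup\mathrm{Int}(S)$ is a *digital disk* and $S$ is a *bounding curve* of $D$. A disk $D$ is *convex* if it has a bounding curve $S$ for which the set of endpoints of the maximal segments of $S$ is the set of vertices of the convex hull of $D$ in $\mathbb R^2$. The interior angle of $S$ at $s_i$ is the angle at $s_i$ between the two maximal segments that meet there, measured on the inner side of the closed polygon through the points of $S$. A disk $D$ is *thick* if for some bounding curve $S$ of $D$: - for every maximal slanted segment $\sigma$ of $S$ and every $p\in\sigma$ that is not an endpoint of $\sigma$, some $c\in D\setminus\sigma$ is diagonally adjacent to $p$; - for every vertex $p$ of an interior angle of $90^\circ$ of $S$ there is a $q\in\mathrm{Int}(S)$ that is diagonally adjacent to $p$ if the angle has axis-parallel sides, and $c_1$-adjacent to $p$ if it has slanted sides; - for every vertex $p$ of an interior angle of $135^\circ$ of $S$ there are $b,b'\in D$ in the interior of the angle with $b$ diagonally adjacent to $p$ and $b'$ $c_1$-adjacent to $p$. **Theorem 6.7.** Let $V_i\subset X\subset\mathbb Z^2$,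 $i\in\{1,\dots,n\}$, where each $V_i$ is a thick convex disk. Let $X'=\bigcup_{i=1}^n V_i$. Let $C_i$ be a bounding curve of $V_i$. Let $B_{1,i}$ be the union of the maximal horizontal and maximal vertical segments of $C_i$, and let $B_{2,i}$ be the set of endpoints of the maximal slanted segments of $C_i$. 1. $B=(X\setminus X')\cup\bigcup_{i=1}^n(B_{1,i}\cup B_{2,i})$ is a freezing set for $(X,c_2)$. 2. Suppose $f:X\to X$ is $c_2$-continuous and every point of $B$ is a $c_2$-approximate fixed point of $f$. Then every point of $X$ is a $c_2$-approximate fixed point of $f$. -/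

import Mathlib

namespace DigitalPlane

/-! ### Adjacencies, continuity, approximate fixed points, freezing sets -/

/-- The `c₁`-adjacency on `ℤ²`: the points differ by `1` in exactly one coordinate
and agree in the other. -/
def c1 : SimpleGraph (ℤ × ℤ) where
  Adj p q := |p.1 - q.1| + |p.2 - q.2| = 1
  symm := ⟨fun p q h => by rw [abs_sub_comm q.1, abs_sub_comm q.2]; exact h⟩
  loopless := ⟨fun p h => by simp at h⟩

/-- The `c₂`-adjacency on `ℤ²`: distinct points that differ by at most `1`
in each coordinate. -/
def c2 : SimpleGraph (ℤ × ℤ) where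
  Adj p q := p ≠ q ∧ |p.1 - q.1| ≤ 1 ∧ |p.2 - q.2| ≤ 1
  symm := ⟨fun p q h => by
    rw [abs_sub_comm q.1, abs_sub_comm q.2]; exact ⟨h.1.symm, h.2⟩⟩
  loopless := ⟨fun p h => h.1 rfl⟩

/-- Adjacent or equal. -/
def AdjOrEq {V : Type*} (G : SimpleGraph V) (x y : V) : Prop := x = y ∨ G.Adj x y

/-- A set of vertices is connected if any two of its points are joined by a path
inside the set. -/
def IsConnectedSet {V : Type*} (G : SimpleGraph V) (A : Set V) : Prop :=
  (G.induce A).Preconnected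

/-- A digital image `(X, κ)` with `X ⊆ ℤ²`, as a graph on the points of `X`. -/
abbrev image (κ : SimpleGraph (ℤ × ℤ)) (X : Set (ℤ × ℤ)) : SimpleGraph X := κ.induce X

/-- Digital continuity of a self-map: connected sets have connected images. -/
def IsDigitallyContinuous {V : Type*} (G : SimpleGraph V) (f : V → V) : Prop :=
  ∀ A : Set V, IsConnectedSet G A → IsConnectedSet G (f '' A)

/-- `x` is an approximate fixed point of `f`. -/
def IsApproxFixedPoint {V : Type*} (G : SimpleGraph V) (f : V → V) (x : V) : Prop :=
  AdjOrEq G x (f x)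

/-- `A` is a freezing set for the digital image `(X, κ)`. -/
def IsFreezingSet (κ : SimpleGraph (ℤ × ℤ)) (X A : Set (ℤ × ℤ)) : Prop :=
  A ⊆ X ∧ ∀ g : X → X, IsDigitallyContinuous (image κ X) g →
    (∀ x : X, (x : ℤ × ℤ) ∈ A → g x = x) → g = id

/-! ### Closed curves -/

/-- A `c₂`-closed curve `s₀, s₁, …, sₘ = s₀` whose points `sᵢ`, `0 ≤ i < m`, are distinct;
the indices are taken modulo the length `m ≥ 1`. -/
structure ClosedCurve where
  len : ℕ
  len_pos : 0 < len
  pt : ZMod len → ℤ × ℤ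
  path : ∀ i, AdjOrEq c2 (pt i) (pt (i + 1))
  inj : Function.Injective pt

namespace ClosedCurve

variable (C : ClosedCurve)

/-- The set of points of the curve. -/
def points : Set (ℤ × ℤ) := Set.range C.pt

/-- The `c₁`-components of the complement of the curve. -/
abbrev ComplComponent : Type := (c1.induce (C.points)ᶜ).ConnectedComponent

/-- The complement of the curve has exactly two `c₁`-components, one finite and the other
infinite. -/
def Bounds : Prop :=
  ∃ I E : C.ComplComponent, I.supp.Finite ∧ E.supp.Infinite ∧ ∀ K, K = I ∨ K = E

/-- The points of the complement that lie in a finite `c₁`-component. (For a curve that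
satisfies `Bounds` there is just one such component.) -/
def inside : Set (ℤ × ℤ) :=
  {z | ∃ h : z ∈ (C.points)ᶜ,
    ((c1.induce (C.points)ᶜ).connectedComponentMk ⟨z, h⟩).supp.Finite}

/-- `C` is a bounding curve of the digital disk `D`. -/
def IsBoundingCurveOf (D : Set (ℤ × ℤ)) : Prop :=
  C.Bounds ∧ D = C.points ∪ C.inside

/-! ### Sides (maximal segments) of a closed curve -/

/-- The step of the curve from its `i`-th point to the next one. -/
def step (i : ZMod C.len) : ℤ × ℤ := C.pt (i + 1) - C.pt i

/-- The set of the points number `i, i + 1, …, i + L` of the curve. -/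
def run (i : ZMod C.len) (L : ℕ) : Set (ℤ × ℤ) :=
  {p | ∃ k : ℕ, k ≤ L ∧ p = C.pt (i + k)}

/-- The points number `i, i + 1, …, i + L` (`L ≥ 1`) form a maximal digital line segment of the
curve: all steps between them agree (as the points of the curve are distinct, this is
collinearity), and the segment extends neither backward nor forward along the curve. -/
def IsMaxSegment (i : ZMod C.len) (L : ℕ) : Prop :=
  1 ≤ L ∧ (∀ k : ℕ, k < L → C.step (i + k) = C.step i) ∧
    C.step (i - 1) ≠ C.step i ∧ C.step (i + L) ≠ C.step i

end ClosedCurve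

/-- Direction vectors of horizontal and vertical segments. -/
def AxisParallel (d : ℤ × ℤ) : Prop := d.1 = 0 ∨ d.2 = 0

/-- Direction vectors of slope `1` or `-1`. -/
def Slanted (d : ℤ × ℤ) : Prop := d.1 ≠ 0 ∧ (d.2 = d.1 ∨ d.2 = -d.1)

namespace ClosedCurve

variable (C : ClosedCurve)

/-- The union of the maximal horizontal and the maximal vertical segments of the curve. -/
def axisParallelPart : Set (ℤ × ℤ) :=
  {p | ∃ i L, C.IsMaxSegment i L ∧ AxisParallel (C.step i) ∧ p ∈ C.run i L}

/-- The endpoints of the maximal slanted segments of the curve. -/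
def slantedEndpoints : Set (ℤ × ℤ) :=
  {p | ∃ i L, C.IsMaxSegment i L ∧ Slanted (C.step i) ∧ (p = C.pt i ∨ p = C.pt (i + L))}

/-- The endpoints of all maximal segments of the curve. -/
def segmentEndpoints : Set (ℤ × ℤ) :=
  {p | ∃ i L, C.IsMaxSegment i L ∧ (p = C.pt i ∨ p = C.pt (i + L))}

end ClosedCurve

/-- `D` is a digital disk. -/
def IsDigitalDisk (D : Set (ℤ × ℤ)) : Prop := ∃ C : ClosedCurve, C.IsBoundingCurveOf D

/-! ### Digital convexity -/

/-- The real plane with its Euclidean metric. -/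
abbrev Plane : Type := EuclideanSpace ℝ (Fin 2)

/-- The inclusion of `ℤ²` in the plane. -/
noncomputable def toPlane (p : ℤ × ℤ) : Plane := !₂[(p.1 : ℝ), (p.2 : ℝ)]

/-- A digital line segment: a finite `c₂`-connected set of collinear points. -/
def IsDigitalLineSegment (Y : Set (ℤ × ℤ)) : Prop :=
  Y.Nonempty ∧ Y.Finite ∧ IsConnectedSet c2 Y ∧ Collinear ℝ (toPlane '' Y)

/-- Digital convexity. The vertices of the polygon `hull(Y)` are its extreme points. -/
def IsDigitallyConvex (Y : Set (ℤ × ℤ)) : Prop :=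
  (∃ p, Y = {p}) ∨ IsDigitalLineSegment Y ∨
    ∃ C : ClosedCurve, C.IsBoundingCurveOf Y ∧
      toPlane '' C.segmentEndpoints = (convexHull ℝ (toPlane '' Y)).extremePoints ℝ

/-! ### Interior angles and thickness -/

/-- The open sector with vertex `p` spanned by the rays from `p` through `a` and `b`
(the convex one, when the rays are not opposite). -/
def openSector (a p b : Plane) : Set Plane :=
  {x | ∃ α β : ℝ, 0 < α ∧ 0 < β ∧ x = p + α • (a - p) + β • (b - p)}

namespace ClosedCurve

variable (C : ClosedCurve)

/-- The closed polygonal line in the plane that joins consecutive points of the curve. -/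
def polygon : Set Plane :=
  ⋃ i, segment ℝ (toPlane (C.pt i)) (toPlane (C.pt (i + 1)))

/-- The region of the plane enclosed by the polygonal line: the points in bounded components
of its complement. -/
def enclosed : Set Plane :=
  {x | x ∉ C.polygon ∧ Bornology.IsBounded (connectedComponentIn (C.polygon)ᶜ x)}

/-- The open convex sector at the `i`-th point, between the directions to the two neighbouring
points of the curve. -/
noncomputable def sector (i : ZMod C.len) : Set Plane :=
  openSector (toPlane (C.pt (i - 1))) (toPlane (C.pt i)) (toPlane (C.pt (i + 1)))

/-- The `i`-th point of the curve is the vertex of an interior angle of `θ` radians, where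
`0 < θ < π`: the sides that meet there form the angle `θ`, and near the vertex the convex sector
between them lies on the inner side of the curve. -/
def HasInteriorAngle (i : ZMod C.len) (θ : ℝ) : Prop :=
  EuclideanGeometry.angle (toPlane (C.pt (i - 1))) (toPlane (C.pt i))
      (toPlane (C.pt (i + 1))) = θ ∧
    ∃ ε > 0, C.sector i ∩ Metric.ball (toPlane (C.pt i)) ε ⊆ C.enclosed

/-- `X` is slant-thick at the point `p` of the slanted segment `σ`: some point `c` of `X`
off `σ` is diagonally adjacent to `p`. -/
def SlantThickAt (X σ : Set (ℤ × ℤ)) (p : ℤ × ℤ) : Prop :=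
  ∃ c ∈ X, c ∉ σ ∧ c2.Adj c p ∧ ¬ c1.Adj c p

/-- 90°-thickness at the vertex number `i`. -/
def Thick90At (i : ZMod C.len) : Prop :=
  ∃ q ∈ C.inside,
    (AxisParallel (C.step (i - 1)) ∧ AxisParallel (C.step i) →
      c2.Adj q (C.pt i) ∧ ¬ c1.Adj q (C.pt i)) ∧
    (Slanted (C.step (i - 1)) ∧ Slanted (C.step i) → c1.Adj q (C.pt i))

/-- 135°-thickness of `X` at the vertex number `i`. -/
def Thick135At (X : Set (ℤ × ℤ)) (i : ZMod C.len) : Prop :=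
  ∃ b ∈ X, ∃ b' ∈ X, toPlane b ∈ C.sector i ∧ toPlane b' ∈ C.sector i ∧
    c2.Adj b (C.pt i) ∧ ¬ c1.Adj b (C.pt i) ∧ c1.Adj b' (C.pt i)

end ClosedCurve

/-- A digital disk `X` is thick if, for some bounding curve, it is slant-thick at every point of
a maximal slanted segment that is not an endpoint of it, 90°-thick at the vertex of every interior
angle of 90°, and 135°-thick at the vertex of every interior angle of 135°. -/
def IsThick (X : Set (ℤ × ℤ)) : Prop :=
  ∃ C : ClosedCurve, C.IsBoundingCurveOf X ∧
    (∀ i L, C.IsMaxSegment i L → Slanted (C.step i) →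
      ∀ k : ℕ, 0 < k → k < L →
        ClosedCurve.SlantThickAt X (C.run i L) (C.pt (i + k))) ∧
    (∀ i, C.HasInteriorAngle i (Real.pi / 2) → C.Thick90At i) ∧
    (∀ i, C.HasInteriorAngle i (3 * Real.pi / 4) → C.Thick135At X i)

/-- Thick convex disks. -/
def IsThickConvexDisk (X : Set (ℤ × ℤ)) : Prop :=
  IsDigitalDisk X ∧ IsDigitallyConvex X ∧ IsThick X

/-- The points of `X` in none of the `Vᵢ`, together with the axis-parallel parts of the curves
`Cᵢ` and the endpoints of their maximal slanted segments. -/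
def freezingCandidate {n : ℕ} (X : Set (ℤ × ℤ)) (V : Fin n → Set (ℤ × ℤ))
    (C : Fin n → ClosedCurve) : Set (ℤ × ℤ) :=
  (X \ ⋃ i, V i) ∪ ⋃ i, ((C i).axisParallelPart ∪ (C i).slantedEndpoints)

end DigitalPlane

/-! ### Continuity as a Lipschitz condition -/

namespace DigitalPlane

/-! A `c2`-continuous map is 1-Lipschitz for the Chebyshev metric on adjacent points, so each
coordinate can be studied separately. Along a digital segment on which a coordinate changes by ±1 at
every step, that coordinate has no slack: if the images of both ends are within `e` of their places,
so are all images in between (`abs_sub_progression_le`).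

On a slanted side both coordinates change at every step, so its endpoints control the whole side;
the axis-parallel sides belong to the candidate set. This settles the curve. Through a point inside
pass a horizontal chord, which controls the first coordinate, and a vertical one, which controls the
second (`exists_chord`). Freezing is the case `e = 0`, approximate fixed points the case `e = 1`. -/

/-- A digitally continuous map moves adjacent points to equal or adjacent points. -/
theorem IsDigitallyContinuous.adjOrEq {V : Type*} {G : SimpleGraph V} {f : V → V}
    (hf : IsDigitallyContinuous G f) {x y : V} (h : G.Adj x y) : AdjOrEq G (f x) (f y) := by
  have hpair : IsConnectedSet G ({x, y} : Set V) :=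
    (SimpleGraph.induce_pair_connected_of_adj h).preconnected
  have himg := hf _ hpair
  rw [Set.image_pair] at himg
  by_contra hne
  simp only [AdjOrEq, not_or] at hne
  obtain ⟨hne, hadj⟩ := hne
  obtain ⟨w⟩ := himg ⟨f x, by simp⟩ ⟨f y, by simp⟩
  -- The first step of a walk inside `{f x, f y}` must leave `f x`, hence lands on `f y`.
  have hnil : ¬ w.Nil := fun h => hne (congrArg Subtype.val h.eq)
  have hw : G.Adj (f x) w.snd := w.adj_snd hnil
  rcases w.snd.2 with h | h
  · exact G.ne_of_adj hw h.symm
  · exact hadj (h ▸ hw)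

/-- An integer sequence with steps at most `1` whose first and `L`-th terms are `e`-close to those
of an arithmetic progression with difference `±1` is `e`-close to it in between. -/
theorem abs_sub_progression_le {u : ℕ → ℤ} {L : ℕ} {a s e : ℤ} (hs : s = 1 ∨ s = -1)
    (hu : ∀ k < L, |u (k + 1) - u k| ≤ 1) (h0 : |u 0 - a| ≤ e) (hL : |u L - (a + L * s)| ≤ e)
    {k : ℕ} (hk : k ≤ L) : |u k - (a + k * s)| ≤ e := by
  have lip : ∀ j m : ℕ, j + m ≤ L → |u (j + m) - u j| ≤ m := by
    intro j m
    induction m with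
    | zero => intro; simp
    | succ m ih =>
      intro h
      have h1 := ih (by omega)
      have h2 := hu (j + m) (by omega)
      rw [← add_assoc]
      push_cast
      rw [abs_le] at *
      omega
  -- For `s = 1` the left end bounds `u k` above and the right end bounds it below; for `s = -1` the
  -- roles swap.
  have h1 := lip 0 k (by omega)
  have h2 := lip k (L - k) (by omega)
  rw [zero_add] at h1
  rw [Nat.add_sub_cancel' hk, Nat.cast_sub hk] at h2
  rw [abs_le] at *
  rcases hs with rfl | rfl <;> omega

/-- `F` moves the points of `X` that are at most `1` apart in each coordinate to points with
the same property. -/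
def IsChebyshevLipschitzOn (F : ℤ × ℤ → ℤ × ℤ) (X : Set (ℤ × ℤ)) : Prop :=
  ∀ p ∈ X, ∀ q ∈ X, |p.1 - q.1| ≤ 1 → |p.2 - q.2| ≤ 1 →
    |(F p).1 - (F q).1| ≤ 1 ∧ |(F p).2 - (F q).2| ≤ 1

/-! ### Displacement along digital segments -/

section Chords

variable {F : ℤ × ℤ → ℤ × ℤ} {X : Set (ℤ × ℤ)} {p d : ℤ × ℤ} {L : ℕ} {e : ℤ}

/-- The second coordinate of `d` matters only for consecutive points to be close, so horizontal and
slanted segments are both covered. -/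
theorem IsChebyshevLipschitzOn.abs_fst_sub_le (hF : IsChebyshevLipschitzOn F X)
    (hX : ∀ k : ℕ, k ≤ L → p + k • d ∈ X) (hd1 : d.1 = 1 ∨ d.1 = -1) (hd2 : |d.2| ≤ 1)
    (h0 : |(F p).1 - p.1| ≤ e) (hL : |(F (p + L • d)).1 - (p + L • d).1| ≤ e)
    {k : ℕ} (hk : k ≤ L) : |(F (p + k • d)).1 - (p + k • d).1| ≤ e := by
  have key := abs_sub_progression_le (u := fun k => (F (p + k • d)).1) (L := L) (a := p.1)
    (s := d.1) (e := e) hd1 ?_ (by simpa using h0) (by simpa using hL) hk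
  · simpa using key
  · intro j hj
    refine (hF _ (hX (j + 1) hj) _ (hX j hj.le) ?_ ?_).1
    · rcases hd1 with h | h <;> simp [add_mul, h]
    · simpa [add_mul] using hd2

theorem IsChebyshevLipschitzOn.abs_snd_sub_le (hF : IsChebyshevLipschitzOn F X)
    (hX : ∀ k : ℕ, k ≤ L → p + k • d ∈ X) (hd1 : |d.1| ≤ 1) (hd2 : d.2 = 1 ∨ d.2 = -1)
    (h0 : |(F p).2 - p.2| ≤ e) (hL : |(F (p + L • d)).2 - (p + L • d).2| ≤ e)
    {k : ℕ} (hk : k ≤ L) : |(F (p + k • d)).2 - (p + k • d).2| ≤ e := by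
  have key := abs_sub_progression_le (u := fun k => (F (p + k • d)).2) (L := L) (a := p.2)
    (s := d.2) (e := e) hd2 ?_ (by simpa using h0) (by simpa using hL) hk
  · simpa using key
  · intro j hj
    refine (hF _ (hX (j + 1) hj) _ (hX j hj.le) ?_ ?_).2
    · simpa [add_mul] using hd1
    · rcases hd2 with h | h <;> simp [add_mul, h]

end Chords

/-! ### Exits from the inside and maximal segments -/

namespace ClosedCurve

variable (C : ClosedCurve)

/-- From a point inside, every walk in an axis direction stays inside until it meets the curve. -/
theorem exists_exit {x d : ℤ × ℤ} (hx : x ∈ C.inside) (hd : |d.1| + |d.2| = 1) :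
    ∃ k : ℕ, 0 < k ∧ x + k • d ∈ C.points ∧ ∀ j < k, x + j • d ∈ C.inside := by
  classical
  obtain ⟨hx0, hfin⟩ := hx
  have reach : ∀ k : ℕ, (∀ j ≤ k, x + j • d ∈ (C.points)ᶜ) →
      ∃ h : x + k • d ∈ (C.points)ᶜ,
        (c1.induce (C.points)ᶜ).connectedComponentMk ⟨x + k • d, h⟩ =
          (c1.induce (C.points)ᶜ).connectedComponentMk ⟨x, hx0⟩ := by
    intro k
    induction k with
    | zero => intro _; simp [hx0]
    | succ k ih =>
      intro h
      obtain ⟨h1, h2⟩ := ih fun j hj => h j (by omega)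
      refine ⟨h _ le_rfl, ?_⟩
      rw [← h2, SimpleGraph.ConnectedComponent.eq]
      apply SimpleGraph.Adj.reachable
      change |_| + |_| = (1 : ℤ)
      simpa [add_mul] using hd
  -- A ray that never met the curve would embed `ℕ` in the finite component of `x`.
  have hex : ∃ k : ℕ, x + k • d ∈ C.points := by
    by_contra! hno
    choose h1 h2 using fun k => reach k fun j _ => hno j
    refine Set.infinite_of_injective_forall_mem
      (f := fun k : ℕ => (⟨x + k • d, h1 k⟩ : ((C.points)ᶜ : Set (ℤ × ℤ)))) ?_ h2 hfin
    intro i j hij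
    have hd0 : d ≠ 0 := by rintro rfl; simp at hd
    have hij' : i • d = j • d := add_left_cancel (Subtype.ext_iff.mp hij)
    rw [← natCast_zsmul, ← natCast_zsmul d j] at hij'
    exact Nat.cast_injective (smul_left_injective ℤ hd0 hij')
  refine ⟨Nat.find hex, ?_, Nat.find_spec hex, ?_⟩
  · rw [Nat.find_pos]
    simpa using hx0
  · intro j hj
    obtain ⟨h1, h2⟩ := reach j fun i hi => Nat.find_min hex (lt_of_le_of_lt hi hj)
    exact ⟨h1, by rw [h2]; exact hfin⟩

/-- A curve that separates the plane has at least two points. -/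
theorem Bounds.one_lt_len {C : ClosedCurve} (h : C.Bounds) : 1 < C.len := by
  obtain ⟨I, -, hI, -⟩ := h
  obtain ⟨⟨x, hx⟩, rfl⟩ := I.exists_rep
  have hin : x ∈ C.inside := ⟨hx, hI⟩
  obtain ⟨k, hk, ⟨i, hi⟩, -⟩ := C.exists_exit (d := (1, 0)) hin (by simp)
  obtain ⟨l, hl, ⟨j, hj⟩, -⟩ := C.exists_exit (d := (-1, 0)) hin (by simp)
  by_contra hlen
  -- The exits to the right and to the left of `x` would be the same point.
  have h1 : C.len = 1 := by have := C.len_pos; omega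
  have hij : i = j := by
    have : Subsingleton (ZMod C.len) := by rw [h1]; infer_instance
    exact Subsingleton.elim _ _
  subst hij
  rw [hi] at hj
  have := congrArg Prod.fst hj
  simp at this
  omega

theorem pt_add_natCast {i : ZMod C.len} {d : ℤ × ℤ} {k : ℕ}
    (h : ∀ j < k, C.step (i + j) = d) : C.pt (i + k) = C.pt i + k • d := by
  induction k with
  | zero => simp
  | succ k ih =>
    have h1 := h k (Nat.lt_succ_self k)
    rw [step, ih fun j hj => h j (by omega)] at h1
    rw [Nat.cast_succ, ← add_assoc, succ_nsmul, ← add_assoc]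
    rw [sub_eq_iff_eq_add] at h1
    rw [h1, add_comm]

/-- A curve with at least two points turns somewhere. -/
theorem exists_step_ne (hlen : 1 < C.len) (i : ZMod C.len) : ∃ t, C.step t ≠ C.step i := by
  by_contra! hall
  -- With constant step `d`, one full turn gives `C.len • d = 0`, so `d = 0`, against injectivity.
  have h := C.pt_add_natCast (i := i) (k := C.len) fun j _ => hall _
  rw [ZMod.natCast_self, add_zero, left_eq_add, smul_eq_zero] at h
  rcases h with h | h
  · omega
  · have h1 := C.inj (sub_eq_zero.mp h)
    have : Fact (1 < C.len) := ⟨hlen⟩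
    exact one_ne_zero (add_eq_left.mp h1)

/-- Every point of the curve lies on a maximal segment. -/
theorem exists_isMaxSegment (hlen : 1 < C.len) (i : ZMod C.len) :
    ∃ (i₀ : ZMod C.len) (L k : ℕ), C.IsMaxSegment i₀ L ∧ k ≤ L ∧ i = i₀ + k := by
  classical
  have : NeZero C.len := ⟨by omega⟩
  obtain ⟨t, ht⟩ := C.exists_step_ne hlen i
  have hfwd : ∃ a : ℕ, C.step (i + a) ≠ C.step i := ⟨(t - i).val, by simpa using ht⟩
  have hbwd : ∃ b : ℕ, C.step (i - b) ≠ C.step i := ⟨(i - t).val, by simpa using ht⟩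
  obtain ⟨a, ha, hamin⟩ : ∃ a : ℕ, C.step (i + a) ≠ C.step i ∧
      ∀ j < a, C.step (i + j) = C.step i :=
    ⟨_, Nat.find_spec hfwd, fun j hj => not_not.mp (Nat.find_min hfwd hj)⟩
  obtain ⟨b, hb, hbmin⟩ : ∃ b : ℕ, C.step (i - b) ≠ C.step i ∧
      ∀ j < b, C.step (i - j) = C.step i :=
    ⟨_, Nat.find_spec hbwd, fun j hj => not_not.mp (Nat.find_min hbwd hj)⟩
  have ha0 : a ≠ 0 := by rintro rfl; simp at ha
  -- The first differing step backward is `b + 1` indices before `i`, so the segment starts `b`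
  -- indices before `i`.
  obtain ⟨b, rfl⟩ : ∃ c, b = c + 1 :=
    Nat.exists_eq_succ_of_ne_zero (by rintro rfl; simp at hb)
  have hstart := hbmin b (Nat.lt_succ_self b)
  refine ⟨i - b, b + a, b, ⟨by omega, ?_, ?_, ?_⟩, by omega, by ring⟩
  · intro k hk
    rw [hstart]
    rcases le_total k b with h | h
    · have := hbmin (b - k) (by omega)
      rw [Nat.cast_sub h] at this
      rwa [show i - (b : ZMod C.len) + k = i - (b - k) by ring]
    · have := hamin (k - b) (by omega)
      rw [Nat.cast_sub h] at this
      rwa [show i - (b : ZMod C.len) + k = i + (k - b) by ring]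
  · rw [hstart, show i - (b : ZMod C.len) - 1 = i - ((b + 1 : ℕ) : ZMod C.len) by push_cast; ring]
    exact hb
  · rw [hstart, show i - (b : ZMod C.len) + ((b + a : ℕ) : ZMod C.len) = i + a by push_cast; ring]
    exact ha

theorem abs_step_le (i : ZMod C.len) : |(C.step i).1| ≤ 1 ∧ |(C.step i).2| ≤ 1 := by
  rcases C.path i with h | h
  · simp [step, ← h]
  · rw [step, Prod.fst_sub, Prod.snd_sub, abs_sub_comm, abs_sub_comm (C.pt (i + 1)).2]
    exact h.2

theorem axisParallelPart_subset : C.axisParallelPart ⊆ C.points := by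
  rintro p ⟨i, L, -, -, k, -, rfl⟩
  exact ⟨_, rfl⟩

theorem slantedEndpoints_subset : C.slantedEndpoints ⊆ C.points := by
  rintro p ⟨i, L, -, -, rfl | rfl⟩ <;> exact ⟨_, rfl⟩

/-! ### From the sides to the curve and its inside -/

variable {C} {F : ℤ × ℤ → ℤ × ℤ} {X : Set (ℤ × ℤ)} {e : ℤ}

/-- If a Lipschitz map moves the points of the axis-parallel sides and the endpoints of the
slanted sides by at most `e`, then it moves all points of the curve by at most `e`. -/
theorem abs_sub_le_of_mem_points (hlen : 1 < C.len) (hCX : C.points ⊆ X)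
    (hF : IsChebyshevLipschitzOn F X)
    (hB : ∀ p ∈ C.axisParallelPart ∪ C.slantedEndpoints,
      |(F p).1 - p.1| ≤ e ∧ |(F p).2 - p.2| ≤ e) {p : ℤ × ℤ} (hp : p ∈ C.points) :
    |(F p).1 - p.1| ≤ e ∧ |(F p).2 - p.2| ≤ e := by
  obtain ⟨i, rfl⟩ := hp
  obtain ⟨i₀, L, k, hseg, hk, rfl⟩ := C.exists_isMaxSegment hlen i
  by_cases hax : AxisParallel (C.step i₀)
  · exact hB _ (Or.inl ⟨i₀, L, hseg, hax, k, hk, rfl⟩)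
  -- Both coordinates of the step are nonzero and at most 1 in size, so the side is slanted.
  obtain ⟨h1, h2⟩ := C.abs_step_le i₀
  simp only [AxisParallel, not_or] at hax
  have hd1 : (C.step i₀).1 = 1 ∨ (C.step i₀).1 = -1 := by rw [abs_le] at h1; omega
  have hd2 : (C.step i₀).2 = 1 ∨ (C.step i₀).2 = -1 := by rw [abs_le] at h2; omega
  have hsl : Slanted (C.step i₀) := ⟨hax.1, by omega⟩
  have hpt : ∀ j ≤ L, C.pt (i₀ + j) = C.pt i₀ + j • C.step i₀ := fun j hj =>
    C.pt_add_natCast fun l hl => hseg.2.1 l (by omega)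
  have h0 := hB _ (Or.inr ⟨i₀, L, hseg, hsl, Or.inl rfl⟩)
  have hL := hB _ (Or.inr ⟨i₀, L, hseg, hsl, Or.inr rfl⟩)
  have hX : ∀ j ≤ L, C.pt i₀ + j • C.step i₀ ∈ X := fun j hj => by
    rw [← hpt j hj]; exact hCX ⟨_, rfl⟩
  rw [hpt L le_rfl] at hL
  rw [hpt k hk]
  exact ⟨hF.abs_fst_sub_le hX hd1 h2 h0.1 hL.1 hk, hF.abs_snd_sub_le hX h1 hd2 h0.2 hL.2 hk⟩

/-- A point inside the curve is the `k`-th point of a chord of length `L` in an axis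
direction `d`, starting at a point `q` of the curve. -/
theorem exists_chord {x d : ℤ × ℤ} (hx : x ∈ C.inside) (hd : |d.1| + |d.2| = 1) :
    ∃ q ∈ C.points, ∃ L k : ℕ, k ≤ L ∧ x = q + k • d ∧ q + L • d ∈ C.points ∧
      ∀ j ≤ L, q + j • d ∈ C.points ∪ C.inside := by
  obtain ⟨a, -, ha, ha'⟩ := C.exists_exit hx hd
  obtain ⟨b, -, hb, hb'⟩ := C.exists_exit (d := -d) hx (by simpa using hd)
  -- The chord is indexed from the backward exit `x - b • d`, which makes `x` its point number `b`.
  have hright : ∀ j, x + b • -d + (b + j) • d = x + j • d := fun j => by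
    rw [add_smul, smul_neg]; abel
  refine ⟨x + b • -d, hb, b + a, b, by omega, ?_, ?_, ?_⟩
  · simp
  · rwa [hright]
  · intro j hj
    rcases le_total b j with h | h
    · obtain ⟨j, rfl⟩ := Nat.exists_eq_add_of_le h
      rw [hright]
      rcases (show j ≤ a by omega).eq_or_lt with rfl | h'
      · exact Or.inl ha
      · exact Or.inr (ha' _ h')
    · obtain ⟨l, rfl⟩ := Nat.exists_eq_add_of_le h
      have hleft : x + (j + l) • -d + j • d = x + l • -d := by
        rw [add_smul, smul_neg, smul_neg]; abel
      rw [hleft]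
      rcases (show l ≤ j + l by omega).eq_or_lt with h' | h'
      · rw [← h'] at hb; exact Or.inl hb
      · exact Or.inr (hb' _ h')

/-- If a Lipschitz map moves the points of the curve by at most `e`, then it moves the points
inside by at most `e`. -/
theorem abs_sub_le_of_mem_inside (hCX : C.points ∪ C.inside ⊆ X)
    (hF : IsChebyshevLipschitzOn F X)
    (hC : ∀ p ∈ C.points, |(F p).1 - p.1| ≤ e ∧ |(F p).2 - p.2| ≤ e)
    {x : ℤ × ℤ} (hx : x ∈ C.inside) :
    |(F x).1 - x.1| ≤ e ∧ |(F x).2 - x.2| ≤ e := by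
  constructor
  · obtain ⟨q, hq, L, k, hk, rfl, hL, hmem⟩ := exists_chord (d := (1, 0)) hx (by simp)
    exact hF.abs_fst_sub_le (fun j hj => hCX (hmem j hj)) (by simp) (by simp)
      (hC _ hq).1 (hC _ hL).1 hk
  · obtain ⟨q, hq, L, k, hk, rfl, hL, hmem⟩ := exists_chord (d := (0, 1)) hx (by simp)
    exact hF.abs_snd_sub_le (fun j hj => hCX (hmem j hj)) (by simp) (by simp)
      (hC _ hq).2 (hC _ hL).2 hk

end ClosedCurve

/-! ### Passing from the disks to `X` -/

theorem freezingCandidate_subset {n : ℕ} {X : Set (ℤ × ℤ)} {V : Fin n → Set (ℤ × ℤ)}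
    {C : Fin n → ClosedCurve} (hCX : ∀ i, (C i).points ⊆ X) :
    freezingCandidate X V C ⊆ X := by
  refine Set.union_subset Set.sdiff_subset (Set.iUnion_subset fun i => ?_)
  exact (Set.union_subset (C i).axisParallelPart_subset (C i).slantedEndpoints_subset).trans
    (hCX i)

/-- A digitally continuous self-map of `X` that moves the points of the freezing candidate by at
most `e` in each coordinate moves all points of `X` by at most `e`. -/
theorem abs_sub_le_of_freezingCandidate {n : ℕ} {X : Set (ℤ × ℤ)} {V : Fin n → Set (ℤ × ℤ)}
    {C : Fin n → ClosedCurve} (hVX : ∀ i, V i ⊆ X) (hC : ∀ i, (C i).IsBoundingCurveOf (V i))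
    {f : X → X} (hf : IsDigitallyContinuous (image c2 X) f) {e : ℤ}
    (hB : ∀ x : X, (x : ℤ × ℤ) ∈ freezingCandidate X V C →
      |(f x).1.1 - x.1.1| ≤ e ∧ |(f x).1.2 - x.1.2| ≤ e) (x : X) :
    |(f x).1.1 - x.1.1| ≤ e ∧ |(f x).1.2 - x.1.2| ≤ e := by
  classical
  -- Extending `f` to the whole lattice frees the arithmetic from membership proofs; the values off
  -- `X` play no role.
  let F : ℤ × ℤ → ℤ × ℤ := fun p => if h : p ∈ X then f ⟨p, h⟩ else p
  have hFX : ∀ y : X, F y = f y := fun y => by simp [F]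
  have hF : IsChebyshevLipschitzOn F X := by
    intro p hp q hq h1 h2
    rw [hFX ⟨p, hp⟩, hFX ⟨q, hq⟩]
    rcases eq_or_ne p q with rfl | hne
    · simp
    have hadj : (image c2 X).Adj ⟨p, hp⟩ ⟨q, hq⟩ := ⟨hne, h1, h2⟩
    rcases hf.adjOrEq hadj with h | h
    · simp [h]
    · exact h.2
  have hcand : ∀ p ∈ freezingCandidate X V C, p ∈ X →
      |(F p).1 - p.1| ≤ e ∧ |(F p).2 - p.2| ≤ e := fun p hp hpX => by
    rw [hFX ⟨p, hpX⟩]; exact hB ⟨p, hpX⟩ hp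
  rw [← hFX]
  by_cases hx : (x : ℤ × ℤ) ∈ ⋃ i, V i
  · obtain ⟨i, hi⟩ := Set.mem_iUnion.mp hx
    obtain ⟨hbounds, hVi⟩ := hC i
    have hCX : (C i).points ∪ (C i).inside ⊆ X := hVi ▸ hVX i
    have hpts : ∀ p ∈ (C i).points, |(F p).1 - p.1| ≤ e ∧ |(F p).2 - p.2| ≤ e := by
      intro p hp
      refine ClosedCurve.abs_sub_le_of_mem_points hbounds.one_lt_len
        (Set.subset_union_left.trans hCX) hF ?_ hp
      intro q hq
      refine hcand q (Or.inr (Set.mem_iUnion.mpr ⟨i, hq⟩)) (hCX (Or.inl ?_))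
      exact Set.union_subset (C i).axisParallelPart_subset (C i).slantedEndpoints_subset hq
    rw [hVi] at hi
    rcases hi with hi | hi
    · exact hpts _ hi
    · exact ClosedCurve.abs_sub_le_of_mem_inside hCX hF hpts hi
  · exact hcand _ (Or.inl ⟨x.2, hx⟩) x.2

/-- This is the displacement bound with `e = 1`; the "equal" case makes up for the irreflexivity of
`c2`. -/
theorem isApproxFixedPoint_image_c2_iff {X : Set (ℤ × ℤ)} {f : X → X} {x : X} :
    IsApproxFixedPoint (image c2 X) f x ↔
      |(f x).1.1 - x.1.1| ≤ 1 ∧ |(f x).1.2 - x.1.2| ≤ 1 := by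
  rw [abs_sub_comm, abs_sub_comm (f x).1.2]
  constructor
  · rintro (h | h)
    · simp [← h]
    · exact h.2
  · intro h
    rcases eq_or_ne x (f x) with hx | hx
    · exact Or.inl hx
    · exact Or.inr ⟨fun h' => hx (Subtype.ext h'), h⟩

end DigitalPlane

theorem theorem6p7 (n : ℕ) (X : Set (ℤ × ℤ)) (V : Fin n → Set (ℤ × ℤ))
    (hVX : ∀ i, V i ⊆ X) (hV : ∀ i, DigitalPlane.IsThickConvexDisk (V i))
    (C : Fin n → DigitalPlane.ClosedCurve)
    (hC : ∀ i, (C i).IsBoundingCurveOf (V i)) :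
    DigitalPlane.IsFreezingSet DigitalPlane.c2 X (DigitalPlane.freezingCandidate X V C) ∧
    ∀ f : X → X,
      DigitalPlane.IsDigitallyContinuous (DigitalPlane.image DigitalPlane.c2 X) f →
      (∀ x : X, (x : ℤ × ℤ) ∈ DigitalPlane.freezingCandidate X V C →
        DigitalPlane.IsApproxFixedPoint (DigitalPlane.image DigitalPlane.c2 X) f x) →
      ∀ x : X, DigitalPlane.IsApproxFixedPoint (DigitalPlane.image DigitalPlane.c2 X) f x := by
  refine ⟨⟨DigitalPlane.freezingCandidate_subset fun i => ?_, fun g hg hfix => ?_⟩,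
    fun f hf happ x => ?_⟩
  · refine Set.subset_union_left.trans (?_ : (C i).points ∪ (C i).inside ⊆ X)
    rw [← (hC i).2]
    exact hVX i
  · funext x
    have h := DigitalPlane.abs_sub_le_of_freezingCandidate hVX hC hg (e := 0)
      (fun y hy => by simp [hfix y hy]) x
    rw [abs_nonpos_iff, abs_nonpos_iff, sub_eq_zero, sub_eq_zero] at h
    exact Subtype.ext (Prod.ext h.1 h.2)
  · exact DigitalPlane.isApproxFixedPoint_image_c2_iff.mpr
      (DigitalPlane.abs_sub_le_of_freezingCandidate hVX hC hf
        (fun y hy => DigitalPlane.isApproxFixedPoint_image_c2_iff.mp (happ y hy)) x)
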